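/- Let $\mathbb{F}$ be an arbitrary field. An $m\times n$ \emph{ACI-matrix} over $\mathbb{F}$ is an $m\times n$ matrix whose entries are polynomials of degree at most one over $\mathbb{F}$ such that no indeterminate appears in two different columns. A \emph{completion} is obtained by assigning values in $\mathbb{F}$ to the indeterminates; the matrix has \emph{constant rank} $\rho$ if all its completions have rank $\rho$, and an $m\times n$ ACI-matrix is \emph{full rank} if it has constant rank $\min\{m,n\}$. An $m\times n$ ACI-matrix is \emph{minimal full rank} if it has constant rank $m<n$ and deleting any one of its columns gives a matrix that is not full rank; it is \emph{maximal full rank} if it has constant rank $n<m$ and for every $v\in\mathbb{F}^m$ the augmented matrix $[A\ v]$ is not full rank. Two $m\times n$ ACI-matrices are equivalent, $A\sim B$, if $TAQ=B$ for some nonsingular constant matrix $T$ of order $m$ and some permutation matrix $Q$ of order $n$. A matrix is \emph{unitriangular} if it is square, upper triangular, with all diagonal entries equal to $1$. A $*$ denotes an arbitrary block. Let $A$ be an $m\times n$ ACI-matrix over $\mathbb{F}$. \textbf{(1)} $A$ has constant rank $\rho$ if and only if $$A\sim\begin{bmatrix} B&*&*\\ 0&0&*\\ 0&0&C\end{bmatrix}$$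 (block rows and block columns may be void) for some ACI-matrices $B$ and $C$ such that $B$ is square upper triangular with nonzero constant diagonal entries or is minimal full rank; $C$ is square upper triangular with nonzero constant diagonal entries or is maximal full rank; and the number of rows of $B$ plus the number of columns of $C$ is $\rho$. \textbf{(2)} Suppose that $A$ has constant rank $\rho$ with $1\le\rho\le\min\{m,n\}$. Then: (i) $\rho=m=n$ if and only if $A\sim U$ for a unitriangular ACI-matrix $U$. (ii) $\rho=m<n$ if and only if $A\sim[\,B\ \ *\,]$, a matrix with fewer rows than columns, where either $B$ is unitriangular or $B$ is an $m\times n'$ minimal full rank ACI-matrix with $m<n'\le n$. (iii) $\rho=n<m$ if and only if $A\sim\begin{bmatrix} *\\ C\end{bmatrix}$, a matrix with more rows than columns, where either $C$ is unitriangular or $C$ is an $m'\times n$ maximal full rank ACI-matrix with $n<m'\le m$. (iv) $\rho<\min\{m,n\}$ if and only if one of the following holds, where in each case $B$ is a unitriangular or minimal full rank ACI-matrix, $C$ is a unitriangular or maximal full rank ACI-matrix, $[\,B\ \ *\,]$ has fewer rows than columns, and $\begin{bmatrix} *\\ C\end{bmatrix}$ has more rows than columns: (a) there are positive integers $r<m$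 and $s<n$ with $\rho=(m-r)+(n-s)$ such that $A\sim\begin{bmatrix} B&*&*\\ 0&0&*\\ 0&0&C\end{bmatrix}$, where the zero blocks together form a zero block of size $r\times s$, $[\,B\ \ *\,]$ is the $(m-r)\times s$ block above it and $\begin{bmatrix} *\\ C\end{bmatrix}$ is the $r\times(n-s)$ block to its right; (b) there is a positive integer $r<m$ with $\rho=m-r$ such that $A\sim\begin{bmatrix} B\ \ *\\ 0_{r\times n}\end{bmatrix}$; (c) there is a positive integer $s<n$ with $\rho=n-s$ such that $A\sim\left[\,0_{m\times s}\ \ \begin{matrix} *\\ C\end{matrix}\,\right]$. -/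

import Mathlib

namespace ACI

variable {σ F ι κ : Type*} [Field F] {a b c d : ℕ}

/-- An ACI-matrix over `F`: the entries are polynomials of degree at most one in indeterminates
indexed by `σ`, and no indeterminate appears in two different columns. -/
def IsACI (A : Matrix ι κ (MvPolynomial σ F)) : Prop :=
  (∀ i j, (A i j).totalDegree ≤ 1) ∧
    ∀ i i' j j', j ≠ j' → Disjoint (A i j).vars (A i' j').vars

/-- The completion of `A` given by the values `x` of the indeterminates. -/
noncomputable def completion (A : Matrix ι κ (MvPolynomial σ F)) (x : σ → F) : Matrix ι κ F :=
  A.map (MvPolynomial.eval x)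

/-- The set of the ranks of the completions of `A`. -/
noncomputable def rankSet [Fintype κ] (A : Matrix ι κ (MvPolynomial σ F)) : Set ℕ :=
  Set.range fun x : σ → F => (completion A x).rank

def HasConstantRank [Fintype κ] (A : Matrix ι κ (MvPolynomial σ F)) (ρ : ℕ) : Prop :=
  rankSet A = {ρ}

def IsFullRank [Fintype ι] [Fintype κ] (A : Matrix ι κ (MvPolynomial σ F)) : Prop :=
  HasConstantRank A (min (Fintype.card ι) (Fintype.card κ))

/-- The matrix obtained from `A` by deleting the column `j`. -/
def deleteCol (A : Matrix ι κ (MvPolynomial σ F)) (j : κ) :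
    Matrix ι {j' : κ // j' ≠ j} (MvPolynomial σ F) :=
  A.submatrix id Subtype.val

/-- The matrix `[A v]` obtained from `A` by adding a constant column `v`. -/
noncomputable def augment (A : Matrix ι κ (MvPolynomial σ F)) (v : ι → F) :
    Matrix ι (κ ⊕ Unit) (MvPolynomial σ F) :=
  Matrix.fromCols A (Matrix.of fun i _ => MvPolynomial.C (v i))

def IsMinimalFullRank (A : Matrix (Fin a) (Fin b) (MvPolynomial σ F)) : Prop :=
  IsACI A ∧ HasConstantRank A a ∧ a < b ∧ ∀ j, ¬ IsFullRank (deleteCol A j)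

def IsMaximalFullRank (A : Matrix (Fin a) (Fin b) (MvPolynomial σ F)) : Prop :=
  IsACI A ∧ HasConstantRank A b ∧ b < a ∧ ∀ v : Fin a → F, ¬ IsFullRank (augment A v)

/-- A square upper triangular ACI-matrix with nonzero constant diagonal entries
(order `0` allowed). -/
def IsUpperTriangular (A : Matrix (Fin a) (Fin b) (MvPolynomial σ F)) : Prop :=
  IsACI A ∧ a = b ∧ (∀ (i : Fin a) (j : Fin b), (j : ℕ) < i → A i j = 0) ∧
    ∀ (i : Fin a) (j : Fin b), (i : ℕ) = j → ∃ t : F, t ≠ 0 ∧ A i j = MvPolynomial.C t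

/-- A square upper triangular ACI-matrix with all diagonal entries equal to `1`. -/
def IsUpperUnitriangular (A : Matrix (Fin a) (Fin b) (MvPolynomial σ F)) : Prop :=
  IsACI A ∧ a = b ∧ (∀ (i : Fin a) (j : Fin b), (j : ℕ) < i → A i j = 0) ∧
    ∀ (i : Fin a) (j : Fin b), (i : ℕ) = j → A i j = 1

/-- `A ∼ B`: there are a nonsingular constant matrix `T` and a permutation matrix `Q`
with `T A Q = B`. -/
def Equivalent (A B : Matrix (Fin a) (Fin b) (MvPolynomial σ F)) : Prop :=
  ∃ (T : Matrix (Fin a) (Fin a) F) (Q : Equiv.Perm (Fin b)), IsUnit T ∧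
    (T.map MvPolynomial.C : Matrix (Fin a) (Fin a) (MvPolynomial σ F)) * A *
      Q.permMatrix (MvPolynomial σ F) = B

/-- The matrix `[X Y]`. -/
def hcat {R : Type*} (X : Matrix (Fin a) (Fin b) R) (Y : Matrix (Fin a) (Fin c) R) :
    Matrix (Fin a) (Fin (b + c)) R :=
  (Matrix.fromCols X Y).submatrix id finSumFinEquiv.symm

/-- The matrix with `X` on top of `Y`. -/
def vcat {R : Type*} (X : Matrix (Fin a) (Fin c) R) (Y : Matrix (Fin b) (Fin c) R) :
    Matrix (Fin (a + b)) (Fin c) R :=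
  (Matrix.fromRows X Y).submatrix finSumFinEquiv.symm id

/-- The block matrix `[[B, X, Y], [0, 0, Z], [0, 0, C]]`; any block may be void. -/
def blockMatrix {R : Type*} [Zero R] {p k u q l v : ℕ} (B : Matrix (Fin p) (Fin q) R)
    (X : Matrix (Fin p) (Fin l) R) (Y : Matrix (Fin p) (Fin v) R) (Z : Matrix (Fin k) (Fin v) R)
    (C : Matrix (Fin u) (Fin v) R) : Matrix (Fin (p + k + u)) (Fin (q + l + v)) R :=
  vcat (vcat (hcat (hcat B X) Y) (hcat (hcat 0 0) Z)) (hcat (hcat 0 0) C)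

/-- `A ∼ [[B, *, *], [0, 0, *], [0, 0, C]]` with `B` triangular or minimal full rank, `C` triangular
or maximal full rank, and (number of rows of `B`) + (number of columns of `C`) equal to `ρ`. -/
def HasBlockForm {m n : ℕ} (A : Matrix (Fin m) (Fin n) (MvPolynomial σ F)) (ρ : ℕ) : Prop :=
  ∃ (p k u q l v : ℕ) (hm : m = p + k + u) (hn : n = q + l + v)
    (B : Matrix (Fin p) (Fin q) (MvPolynomial σ F))
    (X : Matrix (Fin p) (Fin l) (MvPolynomial σ F))
    (Y : Matrix (Fin p) (Fin v) (MvPolynomial σ F))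
    (Z : Matrix (Fin k) (Fin v) (MvPolynomial σ F))
    (C : Matrix (Fin u) (Fin v) (MvPolynomial σ F)),
    (IsUpperTriangular B ∨ IsMinimalFullRank B) ∧
    (IsUpperTriangular C ∨ IsMaximalFullRank C) ∧
    p + v = ρ ∧
    Equivalent A ((blockMatrix B X Y Z C).submatrix (Fin.cast hm) (Fin.cast hn))

/-- `A ∼ [B *]`, a matrix with fewer rows than columns, where `B` is unitriangular, or `m × n'`
minimal full rank with `m < n' ≤ n`. -/
def HasRowForm {m n : ℕ} (A : Matrix (Fin m) (Fin n) (MvPolynomial σ F)) : Prop :=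
  m < n ∧ ∃ (n' l : ℕ) (hn : n = n' + l)
    (B : Matrix (Fin m) (Fin n') (MvPolynomial σ F))
    (X : Matrix (Fin m) (Fin l) (MvPolynomial σ F)),
    (IsUpperUnitriangular B ∨ (IsMinimalFullRank B ∧ m < n' ∧ n' ≤ n)) ∧
    Equivalent A ((hcat B X).submatrix id (Fin.cast hn))

/-- `A ∼ [*; C]`, a matrix with more rows than columns, where `C` is unitriangular, or `m' × n`
maximal full rank with `n < m' ≤ m`. -/
def HasColForm {m n : ℕ} (A : Matrix (Fin m) (Fin n) (MvPolynomial σ F)) : Prop :=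
  n < m ∧ ∃ (m' k : ℕ) (hm : m = k + m')
    (Z : Matrix (Fin k) (Fin n) (MvPolynomial σ F))
    (C : Matrix (Fin m') (Fin n) (MvPolynomial σ F)),
    (IsUpperUnitriangular C ∨ (IsMaximalFullRank C ∧ n < m' ∧ m' ≤ m)) ∧
    Equivalent A ((vcat Z C).submatrix (Fin.cast hm) id)

/-- Pattern (a): for some positive `r < m` and `s < n` with `ρ = (m - r) + (n - s)`,
`A ∼ [[B, *, *], [0, 0, *], [0, 0, C]]` with zero block of size `r × s`, where `[B *]` has fewer
rows than columns and `[*; C]` has more rows than columns. The equations `hm`, `hn` say that the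
zero block has `k + u = r` rows and `q + l = s` columns. -/
def PatternA {m n : ℕ} (A : Matrix (Fin m) (Fin n) (MvPolynomial σ F)) (ρ : ℕ) : Prop :=
  ∃ r s : ℕ, 0 < r ∧ r < m ∧ 0 < s ∧ s < n ∧ ρ = (m - r) + (n - s) ∧
    m - r < s ∧ n - s < r ∧
    ∃ (k u q l : ℕ) (hm : m = m - r + k + u) (hn : n = q + l + (n - s))
      (B : Matrix (Fin (m - r)) (Fin q) (MvPolynomial σ F))
      (X : Matrix (Fin (m - r)) (Fin l) (MvPolynomial σ F))
      (Y : Matrix (Fin (m - r)) (Fin (n - s)) (MvPolynomial σ F))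
      (Z : Matrix (Fin k) (Fin (n - s)) (MvPolynomial σ F))
      (C : Matrix (Fin u) (Fin (n - s)) (MvPolynomial σ F)),
      (IsUpperUnitriangular B ∨ IsMinimalFullRank B) ∧
      (IsUpperUnitriangular C ∨ IsMaximalFullRank C) ∧
      Equivalent A ((blockMatrix B X Y Z C).submatrix (Fin.cast hm) (Fin.cast hn))

/-- Pattern (b): for some positive `r < m` with `ρ = m - r`, `A ∼ [[B, *], [0]]` with zero block of
size `r × n`, where `[B *]` has fewer rows than columns. -/
def PatternB {m n : ℕ} (A : Matrix (Fin m) (Fin n) (MvPolynomial σ F)) (ρ : ℕ) : Prop :=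
  ∃ r : ℕ, 0 < r ∧ r < m ∧ ρ = m - r ∧ m - r < n ∧
    ∃ (q l : ℕ) (hm : m = m - r + r) (hn : n = q + l)
      (B : Matrix (Fin (m - r)) (Fin q) (MvPolynomial σ F))
      (X : Matrix (Fin (m - r)) (Fin l) (MvPolynomial σ F)),
      (IsUpperUnitriangular B ∨ IsMinimalFullRank B) ∧
      Equivalent A
        ((vcat (hcat B X) (0 : Matrix (Fin r) (Fin (q + l)) (MvPolynomial σ F))).submatrix
          (Fin.cast hm) (Fin.cast hn))

/-- Pattern (c): for some positive `s < n` with `ρ = n - s`, `A ∼ [0, [*; C]]` with zero block of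
size `m × s`, where `[*; C]` has more rows than columns. -/
def PatternC {m n : ℕ} (A : Matrix (Fin m) (Fin n) (MvPolynomial σ F)) (ρ : ℕ) : Prop :=
  ∃ s : ℕ, 0 < s ∧ s < n ∧ ρ = n - s ∧ n - s < m ∧
    ∃ (k u : ℕ) (hm : m = k + u) (hn : n = s + (n - s))
      (Z : Matrix (Fin k) (Fin (n - s)) (MvPolynomial σ F))
      (C : Matrix (Fin u) (Fin (n - s)) (MvPolynomial σ F)),
      (IsUpperUnitriangular C ∨ IsMaximalFullRank C) ∧
      Equivalent A
        ((hcat (0 : Matrix (Fin (k + u)) (Fin s) (MvPolynomial σ F)) (vcat Z C)).submatrix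
          (Fin.cast hm) (Fin.cast hn))

end ACI

/-!
The columns of an ACI-matrix can be completed independently of each other, so the completions of
`A` are the transversals of a family of column sets. Rado's min–max formula for the largest rank
of a transversal yields, when all ranks are `ρ`, a set `S` of columns whose completions span a
space `U` with `dim U + #Sᶜ ≤ ρ`. A basis of the column space adapted to `U` turns this into a zero
block of `A`, and the two blocks next to it have full row rank and full column rank. In the square
full rank case, a minimal set of columns spanning no more dimensions than it has members contains
a constant column, so that the unitriangular form follows by induction. A full rank block which is
not square loses columns (or rows, after a change of basis) until it is minimal (or maximal) full
rank or square.
-/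

namespace ACI

open Finset Module Submodule

section Transversals

variable {K V κ : Type*} [DivisionRing K] [AddCommGroup V] [Module K V] [FiniteDimensional K V]

lemma finrank_sup_span_biUnion_submodular [DecidableEq κ] (L : κ → Set V) (D : Submodule K V)
    (R Q : Finset κ) :
    finrank K ↥(D ⊔ span K (⋃ i ∈ R ∪ Q, L i)) + finrank K ↥(D ⊔ span K (⋃ i ∈ R ∩ Q, L i)) ≤
      finrank K ↥(D ⊔ span K (⋃ i ∈ R, L i)) + finrank K ↥(D ⊔ span K (⋃ i ∈ Q, L i)) := by
  rw [set_biUnion_union, span_union, sup_sup_distrib_left,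
    ← finrank_sup_add_finrank_inf_eq (D ⊔ span K (⋃ i ∈ R, L i))]
  refine Nat.add_le_add_left (finrank_mono (le_inf ?_ ?_)) _ <;>
    refine sup_le_sup_left (span_mono (Set.biUnion_subset_biUnion_left fun i hi => ?_)) D
  · exact (mem_inter.1 hi).1
  · exact (mem_inter.1 hi).2

lemma exists_mem_forall_notMem_sup_span [DecidableEq κ] {L : κ → Set V} {D : Submodule K V}
    {s : Finset κ} {j : κ} {m : ℕ} (hj : j ∉ s) (hLj : (L j).Nonempty)
    (h : ∀ R ⊆ insert j s, m ≤ finrank K ↥(D ⊔ span K (⋃ i ∈ R, L i)) + #(insert j s \ R)) :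
    ∃ x ∈ L j, ∀ R ⊆ s, finrank K ↥(D ⊔ span K (⋃ i ∈ R, L i)) + #(s \ R) < m →
      x ∉ D ⊔ span K (⋃ i ∈ R, L i) := by
  by_contra! hcover
  have hcard : ∀ R ⊆ s, #(insert j s \ R) = #(s \ R) + 1 := fun R hR => by
    rw [insert_sdiff_of_notMem _ (fun hjR => hj (hR hjR)), card_insert_of_notMem (by simp [hj])]
  obtain ⟨x₀, hx₀⟩ := hLj
  obtain ⟨R₁, hR₁s, hR₁, -⟩ := hcover x₀ hx₀
  obtain ⟨R₀, hR₀, hmax⟩ := (s.powerset.filter fun R =>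
    finrank K ↥(D ⊔ span K (⋃ i ∈ R, L i)) + #(s \ R) < m).exists_maximal
      ⟨R₁, by simpa using ⟨hR₁s, hR₁⟩⟩
  simp only [mem_filter, mem_powerset, and_imp] at hR₀ hmax
  -- Deficient sets are closed under unions by submodularity, so `R₀` is the largest one.
  have hle : ∀ R ⊆ s, finrank K ↥(D ⊔ span K (⋃ i ∈ R, L i)) + #(s \ R) < m → R ⊆ R₀ := by
    intro R hRs hR
    have hsub := finrank_sup_span_biUnion_submodular L D R R₀
    have hinter := h (R ∩ R₀) ((inter_subset_left.trans hRs).trans (subset_insert j s))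
    have hcup := card_sdiff_add_card_eq_card (union_subset hRs hR₀.1)
    have hcap := card_sdiff_add_card_eq_card ((inter_subset_left (s₂ := R₀)).trans hRs)
    have hcR := card_sdiff_add_card_eq_card hRs
    have hcR₀ := card_sdiff_add_card_eq_card hR₀.1
    have hmod := card_union_add_card_inter R R₀
    rw [hcard _ (inter_subset_left.trans hRs)] at hinter
    exact subset_union_left.trans (hmax (union_subset hRs hR₀.1) (by omega) subset_union_right)
  have hLR₀ : D ⊔ span K (⋃ i ∈ insert j R₀, L i) ≤ D ⊔ span K (⋃ i ∈ R₀, L i) := by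
    rw [set_biUnion_insert, span_union, sup_left_comm]
    refine sup_le (span_le.2 fun x hx => ?_) le_rfl
    obtain ⟨R, hRs, hR, hxR⟩ := hcover x hx
    exact sup_le_sup_left (span_mono (Set.biUnion_subset_biUnion_left (hle R hRs hR))) D hxR
  have hins := h (insert j R₀) (insert_subset_insert j hR₀.1)
  rw [insert_sdiff_insert, sdiff_insert_of_notMem hj] at hins
  have := finrank_mono hLR₀
  omega

theorem exists_transversal_le_finrank {L : κ → Set V} (hne : ∀ i, (L i).Nonempty)
    [DecidableEq κ] (s : Finset κ) (D : Submodule K V) (m : ℕ)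
    (h : ∀ R ⊆ s, m ≤ finrank K ↥(D ⊔ span K (⋃ i ∈ R, L i)) + #(s \ R)) :
    ∃ c : κ → V, (∀ i, c i ∈ L i) ∧ m ≤ finrank K ↥(D ⊔ span K (c '' s)) := by
  induction s using Finset.induction_on generalizing D with
  | empty =>
    choose c hc using hne
    exact ⟨c, hc, (h ∅ Subset.rfl).trans (by simpa using finrank_mono (by simp))⟩
  | insert j s hj ih =>
    obtain ⟨x, hx, hxR⟩ := exists_mem_forall_notMem_sup_span hj (hne j) h
    obtain ⟨c, hc, hm⟩ := ih (D ⊔ span K {x}) fun R hR => by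
      rw [sup_right_comm]
      by_cases hdef : finrank K ↥(D ⊔ span K (⋃ i ∈ R, L i)) + #(s \ R) < m
      · have hR' := h R (hR.trans (subset_insert j s))
        rw [insert_sdiff_of_notMem _ (fun hjR => hj (hR hjR)),
          card_insert_of_notMem (by simp [hj])] at hR'
        rw [finrank_sup_span_singleton (hxR R hR hdef)]
        omega
      · exact (not_lt.1 hdef).trans (Nat.add_le_add_right (finrank_mono le_sup_left) _)
    refine ⟨Function.update c j x, fun i => ?_, ?_⟩
    · rcases eq_or_ne i j with rfl | hij
      · simpa using hx
      · simpa [hij] using hc i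
    · have himage : Function.update c j x '' s = c '' s :=
        Set.image_congr fun i hi => Function.update_of_ne (by rintro rfl; exact hj hi) _ _
      rwa [coe_insert, Set.image_insert_eq, himage, Function.update_self, span_insert, ← sup_assoc]

theorem exists_finrank_span_add_card_compl_le [Fintype κ] [DecidableEq κ] {L : κ → Set V}
    (hne : ∀ i, (L i).Nonempty) {ρ : ℕ}
    (h : ∀ c : κ → V, (∀ i, c i ∈ L i) → finrank K (span K (Set.range c)) ≤ ρ) :
    ∃ S : Finset κ, finrank K (span K (⋃ i ∈ S, L i)) + #Sᶜ ≤ ρ := by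
  by_contra! hlt
  obtain ⟨c, hc, hρ⟩ := exists_transversal_le_finrank (K := K) hne univ ⊥ (ρ + 1)
    fun R _ => by rw [bot_sup_eq, ← compl_eq_univ_sdiff]; exact hlt R
  rw [bot_sup_eq, coe_univ, Set.image_univ] at hρ
  exact absurd (h c hc) (by omega)

/- In a minimal nonempty subfamily `T` spanning at most `#T` dimensions, a nonzero direction `y - x`
of a member `L j` could be completed by a transversal of the other members to the whole span;
moving `x` along this direction would then give a dependent transversal. -/
theorem exists_subsingleton_of_linearIndependent [Fintype κ] [Nonempty κ] {L : κ → Set V}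
    (hne : ∀ i, (L i).Nonempty)
    (hline : ∀ i, ∀ x ∈ L i, ∀ y ∈ L i, ∀ t : K, AffineMap.lineMap x y t ∈ L i)
    (hV : finrank K V ≤ Fintype.card κ)
    (h : ∀ c : κ → V, (∀ i, c i ∈ L i) → LinearIndependent K c) :
    ∃ j, (L j).Subsingleton := by
  classical
  obtain ⟨T, ⟨⟨j, hjT⟩, hT⟩, hmin⟩ := exists_minimal_of_wellFoundedLT
    (fun T : Finset κ => T.Nonempty ∧ finrank K (span K (⋃ i ∈ T, L i)) ≤ #T)
    ⟨univ, univ_nonempty, (Submodule.finrank_le _).trans hV⟩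
  refine ⟨j, fun x hx y hy => ?_⟩
  by_contra hxy
  have hcard := card_erase_add_one hjT
  obtain ⟨c, hc, hcT⟩ := exists_transversal_le_finrank hne (T.erase j) (span K {y - x}) #T <| by
    intro R hR
    rcases R.eq_empty_or_nonempty with rfl | hRne
    · have hdir := finrank_span_singleton (K := K) (sub_ne_zero.2 (Ne.symm hxy))
      have := finrank_mono (le_sup_left : span K {y - x} ≤ _ ⊔ span K (⋃ i ∈ (∅ : Finset κ), L i))
      rw [sdiff_empty]
      omega
    · have hRT : #R < finrank K (span K (⋃ i ∈ R, L i)) := by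
        by_contra! hle
        exact notMem_erase j T (hR (hmin ⟨hRne, hle⟩ (hR.trans (erase_subset j T)) hjT))
      have := finrank_mono (le_sup_right : span K (⋃ i ∈ R, L i) ≤ span K {y - x} ⊔ _)
      have := card_sdiff_add_card_eq_card hR
      omega
  have hspan : span K {y - x} ⊔ span K (c '' T.erase j) = span K (⋃ i ∈ T, L i) := by
    refine eq_of_le_of_finrank_le (sup_le ?_ (span_mono ?_)) (hT.trans hcT)
    · rw [span_singleton_le_iff_mem]
      exact sub_mem (subset_span (Set.mem_biUnion hjT hy)) (subset_span (Set.mem_biUnion hjT hx))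
    · rintro _ ⟨i, hi, rfl⟩
      exact Set.mem_biUnion (mem_of_mem_erase hi) (hc i)
  obtain ⟨_, hw, z, hz, hwz⟩ := mem_sup.1 (hspan ▸ subset_span (Set.mem_biUnion hjT hx))
  obtain ⟨a, rfl⟩ := mem_span_singleton.1 hw
  have hzL : z ∈ L j := by
    convert hline j x hx y hy (-a) using 1
    rw [AffineMap.lineMap_apply_module', neg_smul, eq_neg_add_iff_add_eq, hwz]
  refine (h (Function.update c j z) fun i => ?_).notMem_span_image (notMem_erase j T) ?_
  · rcases eq_or_ne i j with rfl | hij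
    · simpa using hzL
    · simpa [hij] using hc i
  · rwa [Function.update_self, Set.image_congr fun i hi =>
      Function.update_of_ne (ne_of_mem_erase hi) _ _]

end Transversals

section Polynomials

variable {σ R : Type*} [CommRing R]

lemma eq_zero_or_single_of_mem_support {p : MvPolynomial σ R} (hp : p.totalDegree ≤ 1)
    {d : σ →₀ ℕ} (hd : d ∈ p.support) : d = 0 ∨ ∃ i, d = Finsupp.single i 1 := by
  rcases Nat.le_one_iff_eq_zero_or_eq_one.1 ((MvPolynomial.le_totalDegree hd).trans hp) with h | h
  · exact .inl ((Finsupp.degree_eq_zero_iff d).1 h)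
  · exact .inr ((Finsupp.sum_eq_one_iff d).1 h)

lemma eval_lineMap {p : MvPolynomial σ R} (hp : p.totalDegree ≤ 1) (x y : σ → R) (t : R) :
    MvPolynomial.eval (AffineMap.lineMap x y t) p =
      AffineMap.lineMap (MvPolynomial.eval x p) (MvPolynomial.eval y p) t := by
  simp only [AffineMap.lineMap_apply_module', MvPolynomial.eval_eq, smul_eq_mul, mul_sum,
    ← sum_sub_distrib, ← sum_add_distrib]
  refine sum_congr rfl fun d hd => ?_
  rcases eq_zero_or_single_of_mem_support hp hd with rfl | ⟨i, rfl⟩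
  · simp
  · simp only [Finsupp.support_single, ne_eq, one_ne_zero, not_false_eq_true, prod_singleton,
      Finsupp.single_eq_same, pow_one, Pi.add_apply, Pi.smul_apply, Pi.sub_apply,
      smul_eq_mul]
    ring

lemma eq_zero_of_eval_eq_zero {p : MvPolynomial σ R} (hp : p.totalDegree ≤ 1)
    (h : ∀ x, MvPolynomial.eval x p = 0) : p = 0 := by
  classical
  have hconst : p.coeff 0 = 0 := by
    rw [← MvPolynomial.constantCoeff_eq, ← MvPolynomial.eval_zero]
    exact h 0
  have hlin (i : σ) : p.coeff (Finsupp.single i 1) = 0 := by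
    have hi := h (Pi.single i 1)
    rwa [MvPolynomial.eval_eq, sum_eq_single (Finsupp.single i 1), Finsupp.support_single _
      one_ne_zero, prod_singleton, Pi.single_eq_same, one_pow, mul_one] at hi
    · intro d hd hdi
      rcases eq_zero_or_single_of_mem_support hp hd with rfl | ⟨k, rfl⟩
      · exact absurd hconst (MvPolynomial.mem_support_iff.1 hd)
      · have hki : k ≠ i := fun hki => hdi (by rw [hki])
        simp [hki]
    · intro hi'
      rw [MvPolynomial.notMem_support_iff.1 hi', zero_mul]
  ext d
  by_contra hd
  rcases eq_zero_or_single_of_mem_support hp (MvPolynomial.mem_support_iff.2 hd) with rfl | ⟨i, rfl⟩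
  · exact hd hconst
  · exact hd (hlin i)

lemma eq_of_eval_eq {p q : MvPolynomial σ R} (hp : p.totalDegree ≤ 1) (hq : q.totalDegree ≤ 1)
    (h : ∀ x, MvPolynomial.eval x p = MvPolynomial.eval x q) : p = q :=
  sub_eq_zero.1 <| eq_zero_of_eval_eq_zero
    ((MvPolynomial.totalDegree_sub p q).trans (max_le hp hq)) fun x => by
      rw [map_sub, h x, sub_self]

lemma exists_eq_C_of_eval_ne_zero {F : Type*} [Field F] {p : MvPolynomial σ F}
    (hp : p.totalDegree ≤ 1) (h : ∀ x, MvPolynomial.eval x p ≠ 0) :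
    ∃ t ≠ 0, p = MvPolynomial.C t := by
  refine ⟨_, h 0, eq_of_eval_eq hp (by simp) fun x => ?_⟩
  rw [MvPolynomial.eval_C]
  by_contra hx
  set a := MvPolynomial.eval 0 p
  set b := MvPolynomial.eval x p
  refine h (AffineMap.lineMap 0 x (a / (a - b))) ?_
  have hab : a - b ≠ 0 := sub_ne_zero.2 (Ne.symm hx)
  rw [eval_lineMap hp, AffineMap.lineMap_apply_module', smul_eq_mul]
  field_simp
  ring

end Polynomials

section Completions

variable {σ F ι ι' κ κ' : Type*} [Field F]

lemma hasConstantRank_iff [Fintype κ] {A : Matrix ι κ (MvPolynomial σ F)} {ρ : ℕ} :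
    HasConstantRank A ρ ↔ ∀ x, (completion A x).rank = ρ := by
  rw [HasConstantRank, rankSet, Set.range_eq_singleton_iff]

lemma HasConstantRank.unique [Fintype κ] {A : Matrix ι κ (MvPolynomial σ F)} {ρ ρ' : ℕ}
    (h : HasConstantRank A ρ) (h' : HasConstantRank A ρ') : ρ = ρ' :=
  Set.singleton_injective (h.symm.trans h')

@[simp]
lemma completion_apply (A : Matrix ι κ (MvPolynomial σ F)) (x : σ → F) (i : ι) (j : κ) :
    completion A x i j = MvPolynomial.eval x (A i j) := rfl

lemma completion_submatrix (A : Matrix ι κ (MvPolynomial σ F)) (x : σ → F) (f : ι' → ι)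
    (g : κ' → κ) : completion (A.submatrix f g) x = (completion A x).submatrix f g := rfl

lemma completion_map_C_mul [Fintype ι] (T : Matrix ι' ι F) (A : Matrix ι κ (MvPolynomial σ F))
    (x : σ → F) :
    completion ((T.map MvPolynomial.C : Matrix ι' ι (MvPolynomial σ F)) * A) x =
      T * completion A x := by
  ext i j
  simp [Matrix.mul_apply]

lemma completion_fromBlocks_zero (M : Matrix ι κ (MvPolynomial σ F))
    (Y : Matrix ι κ' (MvPolynomial σ F)) (N : Matrix ι' κ' (MvPolynomial σ F)) (x : σ → F) :
    completion (Matrix.fromBlocks M Y 0 N) x =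
      Matrix.fromBlocks (completion M x) (completion Y x) 0 (completion N x) := by
  ext (i | i) (j | j) <;> simp

lemma completion_augment (A : Matrix ι κ (MvPolynomial σ F)) (v : ι → F) (x : σ → F) :
    completion (augment A v) x = Matrix.fromCols (completion A x) (Matrix.of fun i _ => v i) := by
  ext i (j | j) <;> simp [augment]

lemma IsACI.submatrix {A : Matrix ι κ (MvPolynomial σ F)} (hA : IsACI A) (f : ι' → ι)
    {g : κ' → κ} (hg : Function.Injective g) : IsACI (A.submatrix f g) :=
  ⟨fun i j => hA.1 (f i) (g j), fun i i' _ _ hj => hA.2 (f i) (f i') _ _ (hg.ne hj)⟩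

lemma IsACI.map_C_mul [Fintype ι] {A : Matrix ι κ (MvPolynomial σ F)} (hA : IsACI A)
    (T : Matrix ι' ι F) :
    IsACI ((T.map MvPolynomial.C : Matrix ι' ι (MvPolynomial σ F)) * A) := by
  classical
  have hvars : ∀ i j, (((T.map MvPolynomial.C : Matrix ι' ι (MvPolynomial σ F)) * A) i j).vars ⊆
      univ.biUnion fun k => (A k j).vars := fun i j => by
    rw [Matrix.mul_apply]
    refine (MvPolynomial.vars_sum_subset _ _).trans (biUnion_mono fun k _ => ?_)
    simpa using MvPolynomial.vars_mul (MvPolynomial.C (T i k)) (A k j)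
  refine ⟨fun i j => ?_, fun i i' j j' hj => ?_⟩
  · rw [Matrix.mul_apply]
    refine (MvPolynomial.totalDegree_finsetSum _ _).trans (Finset.sup_le fun k _ => ?_)
    exact (MvPolynomial.totalDegree_mul _ _).trans (by simpa using hA.1 k j)
  · refine disjoint_of_subset_left (hvars i j) (disjoint_of_subset_right (hvars i' j') ?_)
    simp only [disjoint_biUnion_left, disjoint_biUnion_right]
    exact fun k _ k' _ => hA.2 _ _ _ _ hj

/-- The set of the columns that the column `j` of `A` becomes in the completions of `A`. -/
def colSet (A : Matrix ι κ (MvPolynomial σ F)) (j : κ) : Set (ι → F) :=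
  Set.range fun x => (completion A x).col j

lemma colSet_nonempty (A : Matrix ι κ (MvPolynomial σ F)) (j : κ) : (colSet A j).Nonempty :=
  Set.range_nonempty _

lemma IsACI.lineMap_mem_colSet {A : Matrix ι κ (MvPolynomial σ F)} (hA : IsACI A) (j : κ)
    {x y : ι → F} (hx : x ∈ colSet A j) (hy : y ∈ colSet A j) (t : F) :
    AffineMap.lineMap x y t ∈ colSet A j := by
  obtain ⟨a, rfl⟩ := hx
  obtain ⟨b, rfl⟩ := hy
  refine ⟨AffineMap.lineMap a b t, funext fun i => ?_⟩
  simpa [AffineMap.lineMap_apply_module'] using eval_lineMap (hA.1 i j) a b t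

lemma IsACI.exists_completion_col_eq {A : Matrix ι κ (MvPolynomial σ F)} (hA : IsACI A)
    {c : κ → ι → F} (hc : ∀ j, c j ∈ colSet A j) : ∃ x, (completion A x).col = c := by
  classical
  choose y hy using hc
  refine ⟨fun a => if h : ∃ j i, a ∈ (A i j).vars then y h.choose a else 0,
    funext fun j => ?_⟩
  rw [← hy j]
  refine funext fun i => MvPolynomial.eval₂Hom_congr' rfl (fun a ha _ => ?_) rfl
  have h : ∃ j i, a ∈ (A i j).vars := ⟨j, i, ha⟩
  have hj : h.choose = j := by
    by_contra hne
    obtain ⟨i', hi'⟩ := h.choose_spec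
    exact Finset.disjoint_left.1 (hA.2 i' i _ _ hne) hi' ha
  simp only [dif_pos h, hj]

end Completions

section Ranks

variable {F ι ι' κ κ' : Type*} [Field F] [Fintype κ]

lemma rank_add_le (M N : Matrix ι κ F) : (M + N).rank ≤ M.rank + N.rank := by
  rw [Matrix.rank, Matrix.mulVecLin_add]
  exact (finrank_mono (LinearMap.range_add_le _ _)).trans (finrank_add_le_finrank_add_finrank _ _)

lemma rank_mul_eq_right_of_leftInverse [Fintype ι] [Fintype ι'] [DecidableEq ι]
    {T : Matrix ι' ι F} {S : Matrix ι ι' F} (h : S * T = 1) (M : Matrix ι κ F) :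
    (T * M).rank = M.rank := by
  refine le_antisymm (Matrix.rank_mul_le_right T M) ?_
  simpa [← Matrix.mul_assoc, h] using Matrix.rank_mul_le_right S (T * M)

lemma exists_rightInverse_of_rank_eq_card [Fintype ι] [DecidableEq ι] {M : Matrix ι κ F}
    (h : M.rank = Fintype.card ι) : ∃ R : Matrix κ ι F, M * R = 1 := by
  rw [← Matrix.mulVec_surjective_iff_exists_right_inverse]
  exact LinearMap.range_eq_top.1 <|
    eq_top_of_finrank_eq (h.trans (finrank_fintype_fun_eq_card F).symm)

lemma exists_leftInverse_of_rank_eq_card [Fintype ι] [DecidableEq κ] {M : Matrix ι κ F}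
    (h : M.rank = Fintype.card κ) : ∃ R : Matrix κ ι F, R * M = 1 := by
  obtain ⟨R, hR⟩ := exists_rightInverse_of_rank_eq_card (M.rank_transpose.trans h)
  exact ⟨R.transpose, by simpa using congrArg Matrix.transpose hR⟩

variable [Fintype κ']

lemma rank_fromBlocks_zero_le_left [Finite ι] (M : Matrix ι κ F) (Y : Matrix ι κ' F)
    (N : Matrix ι' κ' F) :
    (Matrix.fromBlocks M Y 0 N).rank ≤ M.rank + Fintype.card κ' := by
  classical
  cases nonempty_fintype ι
  have hsum : Matrix.fromBlocks M Y 0 N =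
      Matrix.fromRows (1 : Matrix ι ι F) (0 : Matrix ι' ι F) *
        (M * Matrix.fromCols (1 : Matrix κ κ F) (0 : Matrix κ κ' F)) +
        Matrix.fromRows Y N * Matrix.fromCols (0 : Matrix κ' κ F) (1 : Matrix κ' κ' F) := by
    ext (i | i) (j | j) <;> simp [Matrix.mul_fromCols, Matrix.fromRows_mul]
  rw [hsum]
  refine (rank_add_le _ _).trans (add_le_add ?_ ?_)
  · exact (Matrix.rank_mul_le_right _ _).trans (Matrix.rank_mul_le_left _ _)
  · exact (Matrix.rank_mul_le_right _ _).trans (Matrix.rank_le_card_height _)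

lemma rank_fromBlocks_zero_le_right [Fintype ι] [Finite ι'] (M : Matrix ι κ F)
    (Y : Matrix ι κ' F) (N : Matrix ι' κ' F) :
    (Matrix.fromBlocks M Y 0 N).rank ≤ Fintype.card ι + N.rank := by
  cases nonempty_fintype ι'
  have hswap : (Matrix.fromBlocks M Y 0 N).transpose.submatrix (Equiv.sumComm κ' κ)
      (Equiv.sumComm ι' ι) = Matrix.fromBlocks N.transpose Y.transpose 0 M.transpose := by
    ext (i | i) (j | j) <;> rfl
  have hle := rank_fromBlocks_zero_le_left N.transpose Y.transpose M.transpose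
  rwa [← hswap, Matrix.rank_submatrix, Matrix.rank_transpose, Matrix.rank_transpose,
    add_comm] at hle

lemma rank_fromBlocks_zero_of_rank_eq [Fintype ι] [Finite ι'] {M : Matrix ι κ F}
    (Y : Matrix ι κ' F) {N : Matrix ι' κ' F} (hM : M.rank = Fintype.card ι)
    (hN : N.rank = Fintype.card κ') :
    (Matrix.fromBlocks M Y 0 N).rank = Fintype.card ι + Fintype.card κ' := by
  classical
  cases nonempty_fintype ι'
  refine (hM ▸ rank_fromBlocks_zero_le_left M Y N).antisymm ?_
  obtain ⟨R, hR⟩ := exists_rightInverse_of_rank_eq_card hM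
  obtain ⟨L, hL⟩ := exists_leftInverse_of_rank_eq_card hN
  have hone : Matrix.fromBlocks (1 : Matrix ι ι F) 0 0 L * (Matrix.fromBlocks M Y 0 N *
      Matrix.fromBlocks R (-(R * Y)) 0 (1 : Matrix κ' κ' F)) = 1 := by
    simp [Matrix.fromBlocks_multiply, hR, hL, ← Matrix.mul_assoc]
  have hle := congrArg Matrix.rank hone ▸
    (Matrix.rank_mul_le_right _ _).trans (Matrix.rank_mul_le_left _ _)
  rwa [Matrix.rank_one, Fintype.card_sum] at hle

end Ranks

section IndexedEquivalence

variable {σ F : Type*} [Field F] {ι ι' ι'' κ κ' κ'' : Type*} [Fintype ι] [Fintype ι']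
  [Fintype ι''] [DecidableEq ι] [DecidableEq ι'] [DecidableEq ι'']

/-- Equivalence of matrices with arbitrary index types: `B` arises from `A` by a constant invertible
row transformation and a relabelling of the columns. -/
def IndexedEquivalent (A : Matrix ι κ (MvPolynomial σ F)) (B : Matrix ι' κ' (MvPolynomial σ F)) :
    Prop :=
  ∃ (T : Matrix ι' ι F) (S : Matrix ι ι' F) (e : κ' ≃ κ), T * S = 1 ∧ S * T = 1 ∧
    B = ((T.map MvPolynomial.C : Matrix ι' ι (MvPolynomial σ F)) * A).submatrix id e

lemma IndexedEquivalent.trans {A : Matrix ι κ (MvPolynomial σ F)}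
    {B : Matrix ι' κ' (MvPolynomial σ F)} {D : Matrix ι'' κ'' (MvPolynomial σ F)}
    (h : IndexedEquivalent A B) (h' : IndexedEquivalent B D) : IndexedEquivalent A D := by
  obtain ⟨T, S, e, hTS, hST, rfl⟩ := h
  obtain ⟨T', S', e', hTS', hST', rfl⟩ := h'
  refine ⟨T' * T, S * S', e'.trans e, ?_, ?_, ?_⟩
  · rw [Matrix.mul_assoc, ← Matrix.mul_assoc T, hTS, Matrix.one_mul, hTS']
  · rw [Matrix.mul_assoc, ← Matrix.mul_assoc S', hST', Matrix.one_mul, hST]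
  · rw [Matrix.map_mul, Matrix.mul_assoc]
    rfl

lemma indexedEquivalent_submatrix (A : Matrix ι κ (MvPolynomial σ F)) (f : ι' ≃ ι) (e : κ' ≃ κ) :
    IndexedEquivalent A (A.submatrix f e) := by
  refine ⟨(1 : Matrix ι ι F).submatrix f id, (1 : Matrix ι ι F).submatrix id f, e, ?_, ?_, ?_⟩
  · rw [← Matrix.submatrix_mul _ _ _ _ _ Function.bijective_id, Matrix.mul_one,
      Matrix.submatrix_one_equiv]
  · rw [← Matrix.submatrix_mul _ _ _ _ _ f.bijective, Matrix.mul_one]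
    simp
  · ext1 i j
    simp [Matrix.mul_apply, Matrix.one_apply]

lemma IndexedEquivalent.isACI {A : Matrix ι κ (MvPolynomial σ F)}
    {B : Matrix ι' κ' (MvPolynomial σ F)} (h : IndexedEquivalent A B) (hA : IsACI A) : IsACI B := by
  obtain ⟨T, S, e, -, -, rfl⟩ := h
  exact (hA.map_C_mul T).submatrix id e.injective

lemma IndexedEquivalent.rank_completion [Fintype κ] [Fintype κ'] {A : Matrix ι κ (MvPolynomial σ F)}
    {B : Matrix ι' κ' (MvPolynomial σ F)} (h : IndexedEquivalent A B) (x : σ → F) :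
    (completion B x).rank = (completion A x).rank := by
  obtain ⟨T, S, e, -, hST, rfl⟩ := h
  rw [completion_submatrix, completion_map_C_mul]
  exact (Matrix.rank_submatrix _ (Equiv.refl _) e).trans (rank_mul_eq_right_of_leftInverse hST _)

lemma IndexedEquivalent.hasConstantRank_iff [Fintype κ] [Fintype κ']
    {A : Matrix ι κ (MvPolynomial σ F)} {B : Matrix ι' κ' (MvPolynomial σ F)}
    (h : IndexedEquivalent A B) {ρ : ℕ} : HasConstantRank B ρ ↔ HasConstantRank A ρ := by
  simp only [ACI.hasConstantRank_iff, h.rank_completion]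

lemma IndexedEquivalent.fromBlocks {ι₁ ι₂ ι₁' ι₂' κ₁ κ₂ κ₁' κ₂' : Type*} [Fintype ι₁] [Fintype ι₂]
    [Fintype ι₁'] [Fintype ι₂'] [DecidableEq ι₁] [DecidableEq ι₂] [DecidableEq ι₁']
    [DecidableEq ι₂'] {M : Matrix ι₁ κ₁ (MvPolynomial σ F)} {M' : Matrix ι₁' κ₁' (MvPolynomial σ F)}
    {N : Matrix ι₂ κ₂ (MvPolynomial σ F)} {N' : Matrix ι₂' κ₂' (MvPolynomial σ F)}
    (hM : IndexedEquivalent M M') (hN : IndexedEquivalent N N')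
    (Y : Matrix ι₁ κ₂ (MvPolynomial σ F)) :
    ∃ Y', IndexedEquivalent (Matrix.fromBlocks M Y 0 N) (Matrix.fromBlocks M' Y' 0 N') := by
  obtain ⟨T₁, S₁, e₁, hTS₁, hST₁, rfl⟩ := hM
  obtain ⟨T₂, S₂, e₂, hTS₂, hST₂, rfl⟩ := hN
  refine ⟨((T₁.map MvPolynomial.C : Matrix ι₁' ι₁ (MvPolynomial σ F)) * Y).submatrix id e₂,
    Matrix.fromBlocks T₁ 0 0 T₂, Matrix.fromBlocks S₁ 0 0 S₂, Equiv.sumCongr e₁ e₂, ?_, ?_, ?_⟩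
  · simp [Matrix.fromBlocks_multiply, hTS₁, hTS₂]
  · simp [Matrix.fromBlocks_multiply, hST₁, hST₂]
  · rw [Matrix.fromBlocks_map, Matrix.fromBlocks_multiply]
    ext1 (i | i) (j | j) <;> simp [Matrix.fromBlocks]

lemma IndexedEquivalent.fromCols {μ : Type*} {M : Matrix ι κ (MvPolynomial σ F)}
    {M' : Matrix ι' κ' (MvPolynomial σ F)} (hM : IndexedEquivalent M M')
    (X : Matrix ι μ (MvPolynomial σ F)) :
    ∃ X' : Matrix ι' μ (MvPolynomial σ F),
      IndexedEquivalent (Matrix.fromCols M X) (Matrix.fromCols M' X') := by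
  obtain ⟨T, S, e, hTS, hST, rfl⟩ := hM
  refine ⟨(T.map MvPolynomial.C : Matrix ι' ι (MvPolynomial σ F)) * X, T, S,
    Equiv.sumCongr e (Equiv.refl _), hTS, hST, ?_⟩
  rw [Matrix.mul_fromCols]
  ext1 i (j | j) <;> simp

lemma IndexedEquivalent.fromRows {μ : Type*} [Fintype μ] [DecidableEq μ]
    {M : Matrix ι κ (MvPolynomial σ F)}
    {M' : Matrix ι' κ' (MvPolynomial σ F)} (hM : IndexedEquivalent M M')
    (Z : Matrix μ κ (MvPolynomial σ F)) :
    ∃ Z' : Matrix μ κ' (MvPolynomial σ F),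
      IndexedEquivalent (Matrix.fromRows Z M) (Matrix.fromRows Z' M') := by
  obtain ⟨T, S, e, hTS, hST, rfl⟩ := hM
  refine ⟨Z.submatrix id e, Matrix.fromBlocks 1 0 0 T, Matrix.fromBlocks 1 0 0 S, e, ?_, ?_, ?_⟩
  · simp [Matrix.fromBlocks_multiply, hTS]
  · simp [Matrix.fromBlocks_multiply, hST]
  · ext1 (i | i) j <;> simp [Matrix.mul_apply, Fintype.sum_sum_type, Matrix.one_apply]

lemma equivalent_iff_indexedEquivalent {m n : ℕ} {A B : Matrix (Fin m) (Fin n) (MvPolynomial σ F)} :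
    Equivalent A B ↔ IndexedEquivalent A B := by
  constructor
  · rintro ⟨T, Q, hT, rfl⟩
    have hdet := (Matrix.isUnit_iff_isUnit_det T).1 hT
    refine ⟨T, T⁻¹, Q.symm, Matrix.mul_nonsing_inv T hdet, Matrix.nonsing_inv_mul T hdet, ?_⟩
    exact PEquiv.mul_toMatrix_toPEquiv _ _
  · rintro ⟨T, S, e, hTS, hST, rfl⟩
    refine ⟨T, e.symm, ⟨⟨T, S, hTS, hST⟩, rfl⟩, ?_⟩
    exact PEquiv.mul_toMatrix_toPEquiv _ _

end IndexedEquivalence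

section Reduction

variable {σ F : Type*} [Field F]

lemma HasConstantRank.finrank_span_range_eq {ι κ : Type*} [Fintype κ]
    {A : Matrix ι κ (MvPolynomial σ F)} {ρ : ℕ} (hr : HasConstantRank A ρ) (hA : IsACI A)
    {c : κ → ι → F} (hc : ∀ j, c j ∈ colSet A j) : finrank F (span F (Set.range c)) = ρ := by
  obtain ⟨x, rfl⟩ := hA.exists_completion_col_eq hc
  rw [← Matrix.rank_eq_finrank_span_cols, hasConstantRank_iff.1 hr]

lemma HasConstantRank.fromCols {ι κ κ' : Type*} [Fintype ι] [Fintype κ] [Fintype κ']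
    {B : Matrix ι κ (MvPolynomial σ F)} {ρ : ℕ} (h : HasConstantRank B ρ)
    (hρ : Fintype.card ι ≤ ρ) (X : Matrix ι κ' (MvPolynomial σ F)) :
    HasConstantRank (Matrix.fromCols B X) ρ :=
  hasConstantRank_iff.2 fun x => ((Matrix.rank_le_card_height _).trans hρ).antisymm <|
    hasConstantRank_iff.1 h x ▸
      Matrix.rank_submatrix_le (completion (Matrix.fromCols B X) x) id Sum.inl

lemma HasConstantRank.fromRows {ι ι' κ : Type*} [Fintype κ]
    {C : Matrix ι κ (MvPolynomial σ F)} {ρ : ℕ} (h : HasConstantRank C ρ)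
    (hρ : Fintype.card κ ≤ ρ) (Z : Matrix ι' κ (MvPolynomial σ F)) :
    HasConstantRank (Matrix.fromRows Z C) ρ :=
  hasConstantRank_iff.2 fun x => ((Matrix.rank_le_card_width _).trans hρ).antisymm <|
    hasConstantRank_iff.1 h x ▸
      Matrix.rank_submatrix_le (completion (Matrix.fromRows Z C) x) Sum.inr id

lemma HasConstantRank.fromBlocks_zero {ι ι' κ κ' : Type*} [Fintype ι] [Finite ι'] [Fintype κ]
    [Fintype κ'] {M : Matrix ι κ (MvPolynomial σ F)} {N : Matrix ι' κ' (MvPolynomial σ F)}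
    {ρ ρ' : ℕ} (hM : HasConstantRank M ρ) (hN : HasConstantRank N ρ')
    (hρ : Fintype.card ι = ρ) (hρ' : Fintype.card κ' = ρ') (Y : Matrix ι κ' (MvPolynomial σ F)) :
    HasConstantRank (Matrix.fromBlocks M Y 0 N) (ρ + ρ') := by
  subst hρ hρ'
  refine hasConstantRank_iff.2 fun x => ?_
  rw [completion_fromBlocks_zero, rank_fromBlocks_zero_of_rank_eq _ (hasConstantRank_iff.1 hM x)
    (hasConstantRank_iff.1 hN x)]

lemma HasConstantRank.of_fromBlocks_zero {ι ι' κ κ' : Type*} [Fintype ι] [Finite ι'] [Fintype κ]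
    [Fintype κ'] {M : Matrix ι κ (MvPolynomial σ F)} {Y : Matrix ι κ' (MvPolynomial σ F)}
    {N : Matrix ι' κ' (MvPolynomial σ F)} {ρ : ℕ}
    (h : HasConstantRank (Matrix.fromBlocks M Y 0 N) ρ)
    (hρ : Fintype.card ι + Fintype.card κ' ≤ ρ) :
    HasConstantRank M (Fintype.card ι) ∧ HasConstantRank N (Fintype.card κ') := by
  simp only [hasConstantRank_iff, completion_fromBlocks_zero] at h ⊢
  have hM (x) := h x ▸ rank_fromBlocks_zero_le_left (completion M x) (completion Y x)
    (completion N x)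
  have hN (x) := h x ▸ rank_fromBlocks_zero_le_right (completion M x) (completion Y x)
    (completion N x)
  exact ⟨fun x => (Matrix.rank_le_card_height _).antisymm (by have := hM x; omega),
    fun x => (Matrix.rank_le_card_width _).antisymm (by have := hN x; omega)⟩

lemma exists_invertible_mulVec_inr_eq_zero {ι : Type*} [Fintype ι] [DecidableEq ι] {p r : ℕ}
    {U : Submodule F (ι → F)} (hp : finrank F U = p) (hι : Fintype.card ι = p + r) :
    ∃ (T : Matrix (Fin p ⊕ Fin r) ι F) (S : Matrix ι (Fin p ⊕ Fin r) F),
      T * S = 1 ∧ S * T = 1 ∧ ∀ z ∈ U, ∀ i, (T.mulVec z) (Sum.inr i) = 0 := by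
  obtain ⟨W, hUW⟩ := Submodule.exists_isCompl U
  have hW : finrank F W = r := by
    have := finrank_add_eq_of_isCompl hUW
    rw [finrank_fintype_fun_eq_card] at this
    omega
  let b := ((finBasisOfFinrankEq F U hp).prod (finBasisOfFinrankEq F W hW)).map
    (prodEquivOfIsCompl U W hUW)
  refine ⟨b.toMatrix (Pi.basisFun F ι), (Pi.basisFun F ι).toMatrix b,
    b.toMatrix_mul_toMatrix_flip _, (Pi.basisFun F ι).toMatrix_mul_toMatrix_flip b,
    fun z hz i => ?_⟩
  have hrepr : (b.toMatrix (Pi.basisFun F ι)).mulVec z = b.repr z :=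
    (Pi.basisFun F ι).toMatrix_mulVec_repr b z
  rw [hrepr, Basis.map_repr, LinearEquiv.trans_apply, Basis.prod_repr_inr,
    (prodEquivOfIsCompl_symm_apply_snd_eq_zero U W hUW).2 hz, map_zero, Finsupp.zero_apply]

lemma IsACI.exists_fromBlocks_zero_of_finset {m n p r s v : ℕ}
    {A : Matrix (Fin m) (Fin n) (MvPolynomial σ F)} (hA : IsACI A) {S : Finset (Fin n)}
    (hp : finrank F (span F (⋃ j ∈ S, colSet A j)) = p) (hm : m = p + r) (hs : #S = s)
    (hv : #Sᶜ = v) :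
    ∃ (M : Matrix (Fin p) (Fin s) (MvPolynomial σ F)) (Y : Matrix (Fin p) (Fin v) _)
      (N : Matrix (Fin r) (Fin v) _), IsACI M ∧ IsACI N ∧
      IndexedEquivalent A (Matrix.fromBlocks M Y 0 N) := by
  obtain ⟨T, T', hTT', hT'T, hT⟩ :=
    exists_invertible_mulVec_inr_eq_zero hp ((Fintype.card_fin m).trans hm)
  set e := finSumEquivOfFinset hs hv
  set G := ((T.map MvPolynomial.C : Matrix _ _ (MvPolynomial σ F)) * A).submatrix id e
  have hequiv : IndexedEquivalent A G := ⟨T, T', e, hTT', hT'T, rfl⟩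
  have hG := hequiv.isACI hA
  have hzero : G.toBlocks₂₁ = 0 := by
    ext1 i j
    refine eq_zero_of_eval_eq_zero (hG.1 _ _) fun x => ?_
    have hcol : (completion A x).col (e (Sum.inl j)) ∈ span F (⋃ j ∈ S, colSet A j) :=
      subset_span (Set.mem_biUnion (S.orderEmbOfFin_mem hs j) ⟨x, rfl⟩)
    exact (congrFun₂ (completion_map_C_mul T A x) _ _).trans (hT _ hcol i)
  refine ⟨G.toBlocks₁₁, G.toBlocks₁₂, G.toBlocks₂₂, hG.submatrix Sum.inl Sum.inl_injective,
    hG.submatrix Sum.inr Sum.inr_injective, ?_⟩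
  rwa [← hzero, Matrix.fromBlocks_toBlocks]

theorem IsACI.exists_fromBlocks_zero {m n ρ : ℕ} {A : Matrix (Fin m) (Fin n) (MvPolynomial σ F)}
    (hA : IsACI A) (hr : HasConstantRank A ρ) :
    ∃ (p r s v : ℕ) (_ : m = p + r) (_ : n = s + v) (_ : p + v = ρ)
      (M : Matrix (Fin p) (Fin s) (MvPolynomial σ F))
      (Y : Matrix (Fin p) (Fin v) (MvPolynomial σ F))
      (N : Matrix (Fin r) (Fin v) (MvPolynomial σ F)),
      IsACI M ∧ HasConstantRank M p ∧ IsACI N ∧ HasConstantRank N v ∧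
      IndexedEquivalent A (Matrix.fromBlocks M Y 0 N) := by
  obtain ⟨S, hS⟩ := exists_finrank_span_add_card_compl_le (colSet_nonempty A)
    fun c hc => (hr.finrank_span_range_eq hA hc).le
  have hpm : finrank F (span F (⋃ j ∈ S, colSet A j)) ≤ m := by
    simpa using Submodule.finrank_le (span F (⋃ j ∈ S, colSet A j))
  obtain ⟨r, hm⟩ := Nat.exists_eq_add_of_le hpm
  obtain ⟨M, Y, N, hM, hN, hequiv⟩ := hA.exists_fromBlocks_zero_of_finset rfl hm rfl rfl
  have hblocks := hequiv.hasConstantRank_iff.2 hr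
  obtain ⟨hMr, hNr⟩ := hblocks.of_fromBlocks_zero (by simpa using hS)
  rw [Fintype.card_fin] at hMr hNr
  refine ⟨_, r, #S, #Sᶜ, hm, by simp, hS.antisymm ?_, M, Y, N,
    hM, hMr, hN, hNr, hequiv⟩
  have hle := rank_fromBlocks_zero_le_left (completion M 0) (completion Y 0) (completion N 0)
  rwa [← completion_fromBlocks_zero, hasConstantRank_iff.1 hblocks, hasConstantRank_iff.1 hMr,
    Fintype.card_fin] at hle

lemma IsACI.exists_unitriangular_one {A : Matrix (Fin 1) (Fin 1) (MvPolynomial σ F)}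
    (hA : IsACI A) (hr : HasConstantRank A 1) :
    ∃ U : Matrix (Fin 1) (Fin 1) (MvPolynomial σ F),
      IsUpperUnitriangular U ∧ IndexedEquivalent A U := by
  obtain ⟨t, ht, hAt⟩ := exists_eq_C_of_eval_ne_zero (hA.1 0 0) fun x hx => by
    have hzero : completion A x = 0 := by
      ext i j
      rw [Subsingleton.elim i 0, Subsingleton.elim j 0]
      exact hx
    simpa [hzero] using hasConstantRank_iff.1 hr x
  refine ⟨1, ⟨⟨fun i j => ?_, fun i i' j j' hj => (hj (Subsingleton.elim _ _)).elim⟩, rfl,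
    fun i j hij => ?_, fun i j _ => ?_⟩, Matrix.of fun _ _ => t⁻¹, Matrix.of fun _ _ => t,
    Equiv.refl _, ?_, ?_, ?_⟩
  · obtain rfl := Subsingleton.elim i j
    simp [Matrix.one_apply_eq]
  · omega
  · obtain rfl := Subsingleton.elim i j
    rw [Matrix.one_apply_eq]
  · ext i j
    obtain rfl := Subsingleton.elim i j
    simp [Matrix.mul_apply, ht]
  · ext i j
    obtain rfl := Subsingleton.elim i j
    simp [Matrix.mul_apply, ht]
  · ext1 i j
    obtain rfl := Subsingleton.elim i 0
    obtain rfl := Subsingleton.elim j 0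
    simp [Matrix.mul_apply, hAt, ← map_mul, ht]

lemma isUpperUnitriangular_fromBlocks_zero {p q n : ℕ} (hn : n = p + q)
    {U : Matrix (Fin p) (Fin p) (MvPolynomial σ F)} {Y : Matrix (Fin p) (Fin q) (MvPolynomial σ F)}
    {V : Matrix (Fin q) (Fin q) (MvPolynomial σ F)} (hU : IsUpperUnitriangular U)
    (hV : IsUpperUnitriangular V) (hACI : IsACI (Matrix.fromBlocks U Y 0 V)) :
    IsUpperUnitriangular ((Matrix.fromBlocks U Y 0 V).submatrix
      ((finCongr hn).trans finSumFinEquiv.symm) ((finCongr hn).trans finSumFinEquiv.symm)) := by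
  subst hn
  refine ⟨hACI.submatrix _ (Equiv.injective _), rfl, fun i j hij => ?_, fun i j hij => ?_⟩
  all_goals
    obtain ⟨i, rfl⟩ := finSumFinEquiv.surjective i
    obtain ⟨j, rfl⟩ := finSumFinEquiv.surjective j
    rcases i with i | i <;> rcases j with j | j <;>
      simp only [finSumFinEquiv_apply_left, finSumFinEquiv_apply_right, Fin.val_castAdd,
        Fin.val_natAdd] at hij
  · simpa using hU.2.2.1 i j hij
  · omega
  · simp
  · simpa using hV.2.2.1 i j (by omega)
  · simpa using hU.2.2.2 i j hij
  · omega
  · omega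
  · simpa using hV.2.2.2 i j (by omega)

lemma IsACI.exists_finrank_span_colSet_eq_one {n : ℕ}
    {A : Matrix (Fin (n + 1)) (Fin (n + 1)) (MvPolynomial σ F)} (hA : IsACI A)
    (hr : HasConstantRank A (n + 1)) :
    ∃ j, finrank F (span F (colSet A j)) = 1 := by
  have hindep : ∀ c, (∀ j, c j ∈ colSet A j) → LinearIndependent F c := fun c hc => by
    rw [linearIndependent_iff_card_eq_finrank_span, Fintype.card_fin]
    exact (hr.finrank_span_range_eq hA hc).symm
  obtain ⟨j, hj⟩ := exists_subsingleton_of_linearIndependent (K := F) (colSet_nonempty A)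
    (fun j x hx y hy => hA.lineMap_mem_colSet j hx hy) (by simp) hindep
  refine ⟨j, ?_⟩
  have hmem : ∀ j, (completion A 0).col j ∈ colSet A j := fun j => ⟨0, rfl⟩
  rw [hj.eq_singleton_of_mem (hmem j), finrank_span_singleton ((hindep _ hmem).ne_zero j)]

theorem IsACI.exists_unitriangular {n : ℕ} {A : Matrix (Fin n) (Fin n) (MvPolynomial σ F)}
    (hA : IsACI A) (hr : HasConstantRank A n) :
    ∃ U : Matrix (Fin n) (Fin n) (MvPolynomial σ F),
      IsUpperUnitriangular U ∧ IndexedEquivalent A U := by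
  induction n with
  | zero =>
    exact ⟨A, ⟨hA, rfl, fun i => i.elim0, fun i => i.elim0⟩,
      indexedEquivalent_submatrix A (Equiv.refl _) (Equiv.refl _)⟩
  | succ n ih =>
    obtain ⟨j, hj⟩ := hA.exists_finrank_span_colSet_eq_one hr
    obtain ⟨M, Y, N, hM, hN, hequiv⟩ := hA.exists_fromBlocks_zero_of_finset (S := {j}) (p := 1)
      (r := n) (s := 1) (v := n) (by rwa [set_biUnion_singleton]) (add_comm n 1) (card_singleton j)
      (by simp [card_compl])
    obtain ⟨hMr, hNr⟩ := (hequiv.hasConstantRank_iff.2 hr).of_fromBlocks_zero (by simp [add_comm])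
    rw [Fintype.card_fin] at hMr hNr
    obtain ⟨U, hU, hMU⟩ := hM.exists_unitriangular_one hMr
    obtain ⟨V, hV, hNV⟩ := ih hN hNr
    obtain ⟨Y', hY'⟩ := hMU.fromBlocks hNV Y
    exact ⟨_, isUpperUnitriangular_fromBlocks_zero (add_comm n 1) hU hV
      ((hequiv.trans hY').isACI hA), (hequiv.trans hY').trans (indexedEquivalent_submatrix _ _ _)⟩

lemma indexedEquivalent_fromCols_of_isEmpty {ι κ κ' : Type*} [Fintype ι] [DecidableEq ι]
    [IsEmpty κ'] (A : Matrix ι κ (MvPolynomial σ F)) (X : Matrix ι κ' (MvPolynomial σ F)) :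
    IndexedEquivalent A (Matrix.fromCols A X) := by
  convert indexedEquivalent_submatrix A (Equiv.refl ι) (Equiv.sumEmpty κ κ') using 1
  ext1 i (j | j)
  · rfl
  · exact isEmptyElim j

lemma indexedEquivalent_fromRows_of_isEmpty {ι ι' κ : Type*} [Fintype ι] [Fintype ι']
    [DecidableEq ι] [DecidableEq ι'] [IsEmpty ι'] (A : Matrix ι κ (MvPolynomial σ F))
    (Z : Matrix ι' κ (MvPolynomial σ F)) : IndexedEquivalent A (Matrix.fromRows Z A) := by
  convert indexedEquivalent_submatrix A (Equiv.emptySum ι' ι) (Equiv.refl κ) using 1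
  ext1 (i | i) j
  · exact isEmptyElim i
  · rfl

lemma indexedEquivalent_fromCols_hcat {p q l k : ℕ} (B : Matrix (Fin p) (Fin q) (MvPolynomial σ F))
    (X : Matrix (Fin p) (Fin l) (MvPolynomial σ F))
    (Y : Matrix (Fin p) (Fin k) (MvPolynomial σ F)) :
    IndexedEquivalent (Matrix.fromCols (Matrix.fromCols B X) Y)
      (Matrix.fromCols B (hcat X Y)) := by
  convert indexedEquivalent_submatrix (Matrix.fromCols (Matrix.fromCols B X) Y) (Equiv.refl _)
    ((Equiv.sumCongr (Equiv.refl _) finSumFinEquiv.symm).trans (Equiv.sumAssoc _ _ _).symm) using 1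
  ext1 i (j | j)
  · rfl
  · obtain ⟨j | j, rfl⟩ := finSumFinEquiv.surjective j <;> simp [hcat]

lemma indexedEquivalent_fromRows_vcat {k l u v : ℕ} (Y : Matrix (Fin k) (Fin v) (MvPolynomial σ F))
    (Z : Matrix (Fin l) (Fin v) (MvPolynomial σ F))
    (C : Matrix (Fin u) (Fin v) (MvPolynomial σ F)) :
    IndexedEquivalent (Matrix.fromRows Y (Matrix.fromRows Z C))
      (Matrix.fromRows (vcat Y Z) C) := by
  convert indexedEquivalent_submatrix (Matrix.fromRows Y (Matrix.fromRows Z C))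
    ((Equiv.sumCongr finSumFinEquiv.symm (Equiv.refl _)).trans (Equiv.sumAssoc _ _ _))
    (Equiv.refl _) using 1
  ext1 (i | i) j
  · obtain ⟨i | i, rfl⟩ := finSumFinEquiv.surjective i <;> simp [vcat]
  · rfl

lemma IsACI.exists_fromCols_of_not_isMinimalFullRank {p s : ℕ}
    {A : Matrix (Fin p) (Fin (s + 1)) (MvPolynomial σ F)} (hA : IsACI A)
    (hr : HasConstantRank A p) (hps : p ≤ s) (hmin : ¬ IsMinimalFullRank A) :
    ∃ (A' : Matrix (Fin p) (Fin s) (MvPolynomial σ F)) (Y : Matrix (Fin p) (Fin 1) _),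
      IsACI A' ∧ HasConstantRank A' p ∧ IndexedEquivalent A (Matrix.fromCols A' Y) := by
  obtain ⟨j, hj⟩ : ∃ j, IsFullRank (deleteCol A j) := by
    by_contra! h
    exact hmin ⟨hA, hr, Nat.lt_succ_of_le hps, h⟩
  rw [IsFullRank, Fintype.card_fin, Fintype.card_congr (finSuccAboveEquiv j).symm, Fintype.card_fin,
    min_eq_left hps, ← (indexedEquivalent_submatrix (deleteCol A j) (Equiv.refl _)
      (finSuccAboveEquiv j)).hasConstantRank_iff] at hj
  refine ⟨_, A.submatrix id fun _ => j, hA.submatrix id j.succAbove_right_injective, hj, ?_⟩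
  convert indexedEquivalent_submatrix A (Equiv.refl _) (((Equiv.refl _).sumCongr
    (Equiv.ofUnique (Fin 1) Unit)).trans
      ((Equiv.optionEquivSumPUnit _).symm.trans (finSuccEquiv' j).symm)) using 1
  ext1 i (k | k) <;> simp

/- If `[A w]` still has full column rank, row operations turning `w` into the first unit vector make
the first row superfluous for the rank of `A`. -/
lemma IsACI.exists_fromRows_of_not_isMaximalFullRank {u v : ℕ}
    {A : Matrix (Fin (u + 1)) (Fin v) (MvPolynomial σ F)} (hA : IsACI A)
    (hr : HasConstantRank A v) (hvu : v ≤ u) (hmax : ¬ IsMaximalFullRank A) :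
    ∃ (Y : Matrix (Fin 1) (Fin v) (MvPolynomial σ F)) (A' : Matrix (Fin u) (Fin v) _),
      IsACI A' ∧ HasConstantRank A' v ∧ IndexedEquivalent A (Matrix.fromRows Y A') := by
  obtain ⟨w, hw⟩ : ∃ w, IsFullRank (augment A w) := by
    by_contra! h
    exact hmax ⟨hA, hr, Nat.lt_succ_of_le hvu, h⟩
  rw [IsFullRank, Fintype.card_fin, Fintype.card_sum, Fintype.card_fin, Fintype.card_unit,
    min_eq_right (by omega), hasConstantRank_iff] at hw
  simp only [completion_augment] at hw
  have hw0 : w ≠ 0 := by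
    rintro rfl
    obtain ⟨R, hR⟩ := exists_leftInverse_of_rank_eq_card
      ((hw 0).trans (by simp : v + 1 = Fintype.card (Fin v ⊕ Unit)))
    have hone := congrFun₂ hR (Sum.inr ()) (Sum.inr ())
    simp [Matrix.mul_apply] at hone
  obtain ⟨T, S, hTS, hST, hT⟩ := exists_invertible_mulVec_inr_eq_zero (r := u)
    (finrank_span_singleton (K := F) hw0) (by simp [add_comm])
  set G := (T.map MvPolynomial.C : Matrix _ _ (MvPolynomial σ F)) * A
  refine ⟨G.toRows₁, G.toRows₂, (hA.map_C_mul T).submatrix Sum.inr Function.injective_id,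
    hasConstantRank_iff.2 fun x => (Matrix.rank_le_width _).antisymm ?_,
    T, S, Equiv.refl _, hTS, hST, Matrix.fromRows_toRows G⟩
  have hblocks : (T * Matrix.fromCols (completion A x) (Matrix.of fun i _ => w i)).submatrix id
      (Equiv.sumComm Unit (Fin v)) = Matrix.fromBlocks (Matrix.of fun i _ => T.mulVec w (Sum.inl i))
        (completion G.toRows₁ x) 0 (completion G.toRows₂ x) := by
    rw [Matrix.mul_fromCols, ← completion_map_C_mul]
    ext (i | i) (j | j)
    · rfl
    · rfl
    · exact hT w (mem_span_singleton_self w) i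
    · rfl
  have hle := rank_fromBlocks_zero_le_right (Matrix.of fun i (_ : Unit) => T.mulVec w (Sum.inl i))
    (completion G.toRows₁ x) (completion G.toRows₂ x)
  rw [← hblocks, ← Equiv.coe_refl, Matrix.rank_submatrix, rank_mul_eq_right_of_leftInverse hST,
    hw x, Fintype.card_fin] at hle
  omega

theorem IsACI.exists_fromCols {p s : ℕ} {A : Matrix (Fin p) (Fin s) (MvPolynomial σ F)}
    (hA : IsACI A) (hr : HasConstantRank A p) :
    ∃ (q l : ℕ) (_ : s = q + l) (B : Matrix (Fin p) (Fin q) (MvPolynomial σ F))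
      (X : Matrix (Fin p) (Fin l) (MvPolynomial σ F)),
      (IsUpperUnitriangular B ∨ IsMinimalFullRank B) ∧
      IndexedEquivalent A (Matrix.fromCols B X) := by
  obtain ⟨d, rfl⟩ := Nat.exists_eq_add_of_le
    ((hasConstantRank_iff.1 hr 0).symm.le.trans (Matrix.rank_le_width _))
  induction d with
  | zero =>
    obtain ⟨U, hU, hequiv⟩ := hA.exists_unitriangular hr
    exact ⟨p, 0, rfl, U, 0, .inl hU, hequiv.trans (indexedEquivalent_fromCols_of_isEmpty U 0)⟩
  | succ d ih =>
    by_cases hmin : IsMinimalFullRank A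
    · exact ⟨_, 0, rfl, A, 0, .inr hmin, indexedEquivalent_fromCols_of_isEmpty A 0⟩
    · obtain ⟨A', Y, hA', hr', hequiv⟩ :=
        hA.exists_fromCols_of_not_isMinimalFullRank hr (Nat.le_add_right p d) hmin
      obtain ⟨q, l, hs, B, X, hB, hBX⟩ := ih hA' hr'
      obtain ⟨Y', hY'⟩ := hBX.fromCols Y
      exact ⟨q, l + 1, by omega, B, hcat X Y', hB,
        (hequiv.trans hY').trans (indexedEquivalent_fromCols_hcat B X Y')⟩

theorem IsACI.exists_fromRows {r v : ℕ} {A : Matrix (Fin r) (Fin v) (MvPolynomial σ F)}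
    (hA : IsACI A) (hr : HasConstantRank A v) :
    ∃ (k u : ℕ) (_ : r = k + u) (Z : Matrix (Fin k) (Fin v) (MvPolynomial σ F))
      (C : Matrix (Fin u) (Fin v) (MvPolynomial σ F)),
      (IsUpperUnitriangular C ∨ IsMaximalFullRank C) ∧
      IndexedEquivalent A (Matrix.fromRows Z C) := by
  obtain ⟨d, rfl⟩ := Nat.exists_eq_add_of_le
    ((hasConstantRank_iff.1 hr 0).symm.le.trans (Matrix.rank_le_height _))
  induction d with
  | zero =>
    obtain ⟨U, hU, hequiv⟩ := hA.exists_unitriangular hr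
    exact ⟨0, v, (zero_add v).symm, 0, U, .inl hU,
      hequiv.trans (indexedEquivalent_fromRows_of_isEmpty U 0)⟩
  | succ d ih =>
    by_cases hmax : IsMaximalFullRank A
    · exact ⟨0, _, (zero_add _).symm, 0, A, .inr hmax, indexedEquivalent_fromRows_of_isEmpty A 0⟩
    · obtain ⟨Y, A', hA', hr', hequiv⟩ :=
        hA.exists_fromRows_of_not_isMaximalFullRank hr (Nat.le_add_right v d) hmax
      obtain ⟨k, u, hs, Z, C, hC, hZC⟩ := ih hA' hr'
      obtain ⟨Y', hY'⟩ := hZC.fromRows Y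
      exact ⟨1 + k, u, by omega, vcat Y' Z, C, hC,
        (hequiv.trans hY').trans (indexedEquivalent_fromRows_vcat Y' Z C)⟩

end Reduction

section Forms

variable {σ F : Type*} [Field F]

lemma IsUpperUnitriangular.isUpperTriangular {a b : ℕ}
    {A : Matrix (Fin a) (Fin b) (MvPolynomial σ F)} (h : IsUpperUnitriangular A) :
    IsUpperTriangular A :=
  ⟨h.1, h.2.1, h.2.2.1, fun i j hij => ⟨1, one_ne_zero, by rw [h.2.2.2 i j hij, map_one]⟩⟩

lemma IsUpperTriangular.hasConstantRank {a b : ℕ}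
    {A : Matrix (Fin a) (Fin b) (MvPolynomial σ F)} (h : IsUpperTriangular A) :
    HasConstantRank A a := by
  obtain ⟨-, rfl, hlow, hdiag⟩ := h
  refine hasConstantRank_iff.2 fun x => ?_
  have htri : (completion A x).IsUpperTriangular := fun i j hij => by
    rw [completion_apply, hlow i j hij, map_zero]
  have hdet : IsUnit (completion A x).det := by
    rw [Matrix.det_of_isUpperTriangular htri, isUnit_iff_ne_zero, prod_ne_zero_iff]
    intro i _
    obtain ⟨t, ht, hAt⟩ := hdiag i i rfl
    rwa [completion_apply, hAt, MvPolynomial.eval_C]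
  rw [Matrix.rank_of_isUnit _ ((Matrix.isUnit_iff_isUnit_det _).2 hdet), Fintype.card_fin]

lemma hasConstantRank_of_triangular_or_minimal {a b : ℕ}
    {B : Matrix (Fin a) (Fin b) (MvPolynomial σ F)}
    (h : IsUpperTriangular B ∨ IsMinimalFullRank B) : HasConstantRank B a :=
  h.elim (fun h => h.hasConstantRank) fun h => h.2.1

lemma hasConstantRank_of_triangular_or_maximal {a b : ℕ}
    {C : Matrix (Fin a) (Fin b) (MvPolynomial σ F)}
    (h : IsUpperTriangular C ∨ IsMaximalFullRank C) : HasConstantRank C b :=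
  h.elim (fun h => h.2.1 ▸ h.hasConstantRank) fun h => h.2.1

lemma indexedEquivalent_hcat {m n q l : ℕ} (hn : n = q + l)
    (B : Matrix (Fin m) (Fin q) (MvPolynomial σ F))
    (X : Matrix (Fin m) (Fin l) (MvPolynomial σ F)) :
    IndexedEquivalent (Matrix.fromCols B X) ((hcat B X).submatrix id (Fin.cast hn)) :=
  indexedEquivalent_submatrix _ (Equiv.refl _) ((finCongr hn).trans finSumFinEquiv.symm)

lemma indexedEquivalent_vcat {m n k u : ℕ} (hm : m = k + u)
    (Z : Matrix (Fin k) (Fin n) (MvPolynomial σ F))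
    (C : Matrix (Fin u) (Fin n) (MvPolynomial σ F)) :
    IndexedEquivalent (Matrix.fromRows Z C) ((vcat Z C).submatrix (Fin.cast hm) id) :=
  indexedEquivalent_submatrix _ ((finCongr hm).trans finSumFinEquiv.symm) (Equiv.refl _)

lemma blockMatrix_eq_submatrix {R : Type*} [Zero R] {p k u q l v : ℕ}
    (B : Matrix (Fin p) (Fin q) R) (X : Matrix (Fin p) (Fin l) R) (Y : Matrix (Fin p) (Fin v) R)
    (Z : Matrix (Fin k) (Fin v) R) (C : Matrix (Fin u) (Fin v) R) :
    blockMatrix B X Y Z C =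
      (Matrix.fromBlocks (Matrix.fromCols B X) Y 0 (Matrix.fromRows Z C)).submatrix
        ((finSumFinEquiv.symm.trans (Equiv.sumCongr finSumFinEquiv.symm (Equiv.refl _))).trans
          (Equiv.sumAssoc _ _ _))
        (finSumFinEquiv.symm.trans (Equiv.sumCongr finSumFinEquiv.symm (Equiv.refl _))) := by
  ext i j
  obtain ⟨i, rfl⟩ := finSumFinEquiv.surjective i
  obtain ⟨j, rfl⟩ := finSumFinEquiv.surjective j
  rcases i with i | i
  · obtain ⟨i, rfl⟩ := finSumFinEquiv.surjective i
    rcases j with j | j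
    · obtain ⟨j, rfl⟩ := finSumFinEquiv.surjective j
      rcases i with i | i <;> rcases j with j | j <;> simp [blockMatrix, vcat, hcat]
    · rcases i with i | i <;> simp [blockMatrix, vcat, hcat]
  · rcases j with j | j
    · obtain ⟨j, rfl⟩ := finSumFinEquiv.surjective j
      rcases j with j | j <;> simp [blockMatrix, vcat, hcat]
    · simp [blockMatrix, vcat, hcat]

lemma indexedEquivalent_blockMatrix {m n p k u q l v : ℕ} (hm : m = p + k + u)
    (hn : n = q + l + v) (B : Matrix (Fin p) (Fin q) (MvPolynomial σ F))
    (X : Matrix (Fin p) (Fin l) (MvPolynomial σ F)) (Y : Matrix (Fin p) (Fin v) (MvPolynomial σ F))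
    (Z : Matrix (Fin k) (Fin v) (MvPolynomial σ F))
    (C : Matrix (Fin u) (Fin v) (MvPolynomial σ F)) :
    IndexedEquivalent (Matrix.fromBlocks (Matrix.fromCols B X) Y 0 (Matrix.fromRows Z C))
      ((blockMatrix B X Y Z C).submatrix (Fin.cast hm) (Fin.cast hn)) := by
  rw [blockMatrix_eq_submatrix]
  exact (indexedEquivalent_submatrix _ _ _).trans
    (indexedEquivalent_submatrix _ (finCongr hm) (finCongr hn))

lemma indexedEquivalent_vcat_hcat_zero {m n p k u q l : ℕ} (hm : m = p + (k + u))
    (hn : n = q + l) (B : Matrix (Fin p) (Fin q) (MvPolynomial σ F))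
    (X : Matrix (Fin p) (Fin l) (MvPolynomial σ F)) (Y : Matrix (Fin p) (Fin 0) (MvPolynomial σ F))
    (N : Matrix (Fin k ⊕ Fin u) (Fin 0) (MvPolynomial σ F)) :
    IndexedEquivalent (Matrix.fromBlocks (Matrix.fromCols B X) Y 0 N)
      ((vcat (hcat B X) (0 : Matrix (Fin (k + u)) (Fin (q + l)) (MvPolynomial σ F))).submatrix
        (Fin.cast hm) (Fin.cast hn)) := by
  have h : vcat (hcat B X) (0 : Matrix (Fin (k + u)) (Fin (q + l)) (MvPolynomial σ F)) =
      (Matrix.fromBlocks (Matrix.fromCols B X) Y 0 N).submatrix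
        (finSumFinEquiv.symm.trans (Equiv.sumCongr (Equiv.refl _) finSumFinEquiv.symm))
        (finSumFinEquiv.symm.trans (Equiv.sumEmpty _ _).symm) := by
    ext1 i j
    obtain ⟨i, rfl⟩ := finSumFinEquiv.surjective i
    obtain ⟨j, rfl⟩ := finSumFinEquiv.surjective j
    rcases i with i | i <;> simp [vcat, hcat]
  rw [h]
  exact (indexedEquivalent_submatrix _ _ _).trans
    (indexedEquivalent_submatrix _ (finCongr hm) (finCongr hn))

lemma indexedEquivalent_hcat_zero_vcat {m n k u q l v : ℕ} (hm : m = k + u)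
    (hn : n = (q + l) + v) (M : Matrix (Fin 0) (Fin q ⊕ Fin l) (MvPolynomial σ F))
    (Y : Matrix (Fin 0) (Fin v) (MvPolynomial σ F)) (Z : Matrix (Fin k) (Fin v) (MvPolynomial σ F))
    (C : Matrix (Fin u) (Fin v) (MvPolynomial σ F)) :
    IndexedEquivalent (Matrix.fromBlocks M Y 0 (Matrix.fromRows Z C))
      ((hcat (0 : Matrix (Fin (k + u)) (Fin (q + l)) (MvPolynomial σ F)) (vcat Z C)).submatrix
        (Fin.cast hm) (Fin.cast hn)) := by
  have h : hcat (0 : Matrix (Fin (k + u)) (Fin (q + l)) (MvPolynomial σ F)) (vcat Z C) =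
      (Matrix.fromBlocks M Y 0 (Matrix.fromRows Z C)).submatrix
        (finSumFinEquiv.symm.trans (Equiv.emptySum _ _).symm)
        (finSumFinEquiv.symm.trans (Equiv.sumCongr finSumFinEquiv.symm (Equiv.refl _))) := by
    ext1 i j
    obtain ⟨i, rfl⟩ := finSumFinEquiv.surjective i
    obtain ⟨j, rfl⟩ := finSumFinEquiv.surjective j
    rcases j with j | j <;> simp [vcat, hcat]
  rw [h]
  exact (indexedEquivalent_submatrix _ _ _).trans
    (indexedEquivalent_submatrix _ (finCongr hm) (finCongr hn))

theorem IsACI.exists_fromBlocks_fromCols_fromRows {m n ρ : ℕ}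
    {A : Matrix (Fin m) (Fin n) (MvPolynomial σ F)}
    (hA : IsACI A) (hr : HasConstantRank A ρ) :
    ∃ (p k u q l v : ℕ) (_ : m = p + k + u) (_ : n = q + l + v) (_ : p + v = ρ)
      (B : Matrix (Fin p) (Fin q) (MvPolynomial σ F))
      (X : Matrix (Fin p) (Fin l) (MvPolynomial σ F))
      (Y : Matrix (Fin p) (Fin v) (MvPolynomial σ F))
      (Z : Matrix (Fin k) (Fin v) (MvPolynomial σ F))
      (C : Matrix (Fin u) (Fin v) (MvPolynomial σ F)),
      (IsUpperUnitriangular B ∨ IsMinimalFullRank B) ∧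
      (IsUpperUnitriangular C ∨ IsMaximalFullRank C) ∧
      IndexedEquivalent A
        (Matrix.fromBlocks (Matrix.fromCols B X) Y 0 (Matrix.fromRows Z C)) := by
  obtain ⟨p, r, s, v, hm, hn, hρ, M, Y, N, hM, hMr, hN, hNr, hequiv⟩ := hA.exists_fromBlocks_zero hr
  obtain ⟨q, l, hs, B, X, hB, hMB⟩ := hM.exists_fromCols hMr
  obtain ⟨k, u, hr, Z, C, hC, hNC⟩ := hN.exists_fromRows hNr
  obtain ⟨Y', hY'⟩ := hMB.fromBlocks hNC Y
  exact ⟨p, k, u, q, l, v, by omega, by omega, hρ, B, X, Y', Z, C, hB, hC, hequiv.trans hY'⟩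

theorem HasBlockForm.hasConstantRank {m n ρ : ℕ} {A : Matrix (Fin m) (Fin n) (MvPolynomial σ F)}
    (h : HasBlockForm A ρ) : HasConstantRank A ρ := by
  obtain ⟨p, k, u, q, l, v, hm, hn, B, X, Y, Z, C, hB, hC, rfl, hequiv⟩ := h
  rw [← (equivalent_iff_indexedEquivalent.1 hequiv).hasConstantRank_iff,
    (indexedEquivalent_blockMatrix hm hn B X Y Z C).hasConstantRank_iff]
  have hBX := (hasConstantRank_of_triangular_or_minimal hB).fromCols (Fintype.card_fin p).le X
  have hZC := (hasConstantRank_of_triangular_or_maximal hC).fromRows (Fintype.card_fin v).le Z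
  exact hBX.fromBlocks_zero hZC (Fintype.card_fin p) (Fintype.card_fin v) Y

theorem IsACI.hasBlockForm {m n ρ : ℕ} {A : Matrix (Fin m) (Fin n) (MvPolynomial σ F)}
    (hA : IsACI A) (hr : HasConstantRank A ρ) : HasBlockForm A ρ := by
  obtain ⟨p, k, u, q, l, v, hm, hn, hρ, B, X, Y, Z, C, hB, hC, hequiv⟩ :=
    hA.exists_fromBlocks_fromCols_fromRows hr
  exact ⟨p, k, u, q, l, v, hm, hn, B, X, Y, Z, C,
    hB.imp_left fun h => h.isUpperTriangular, hC.imp_left fun h => h.isUpperTriangular, hρ,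
    equivalent_iff_indexedEquivalent.2
      (hequiv.trans (indexedEquivalent_blockMatrix hm hn B X Y Z C))⟩

lemma IsUpperUnitriangular.hasConstantRank_of_equivalent {m n : ℕ}
    {A U : Matrix (Fin m) (Fin n) (MvPolynomial σ F)} (hU : IsUpperUnitriangular U)
    (hequiv : Equivalent A U) : HasConstantRank A m :=
  (equivalent_iff_indexedEquivalent.1 hequiv).hasConstantRank_iff.1
    hU.isUpperTriangular.hasConstantRank

theorem HasRowForm.hasConstantRank {m n : ℕ} {A : Matrix (Fin m) (Fin n) (MvPolynomial σ F)}
    (h : HasRowForm A) : HasConstantRank A m := by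
  obtain ⟨-, q, l, hn, B, X, hB, hequiv⟩ := h
  rw [← (equivalent_iff_indexedEquivalent.1 hequiv).hasConstantRank_iff,
    (indexedEquivalent_hcat hn B X).hasConstantRank_iff]
  exact (hasConstantRank_of_triangular_or_minimal
    (hB.imp (fun h => h.isUpperTriangular) fun h => h.1)).fromCols (Fintype.card_fin m).le X

theorem HasColForm.hasConstantRank {m n : ℕ} {A : Matrix (Fin m) (Fin n) (MvPolynomial σ F)}
    (h : HasColForm A) : HasConstantRank A n := by
  obtain ⟨-, u, k, hm, Z, C, hC, hequiv⟩ := h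
  rw [← (equivalent_iff_indexedEquivalent.1 hequiv).hasConstantRank_iff,
    (indexedEquivalent_vcat hm Z C).hasConstantRank_iff]
  exact (hasConstantRank_of_triangular_or_maximal
    (hC.imp (fun h => h.isUpperTriangular) fun h => h.1)).fromRows (Fintype.card_fin n).le Z

theorem IsACI.hasRowForm {m n : ℕ} {A : Matrix (Fin m) (Fin n) (MvPolynomial σ F)}
    (hA : IsACI A) (hr : HasConstantRank A m) (hmn : m < n) : HasRowForm A := by
  obtain ⟨q, l, hn, B, X, hB, hequiv⟩ := hA.exists_fromCols hr
  exact ⟨hmn, q, l, hn, B, X, hB.imp_right fun h => ⟨h, h.2.2.1, by omega⟩,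
    equivalent_iff_indexedEquivalent.2 (hequiv.trans (indexedEquivalent_hcat hn B X))⟩

theorem IsACI.hasColForm {m n : ℕ} {A : Matrix (Fin m) (Fin n) (MvPolynomial σ F)}
    (hA : IsACI A) (hr : HasConstantRank A n) (hmn : n < m) : HasColForm A := by
  obtain ⟨k, u, hm, Z, C, hC, hequiv⟩ := hA.exists_fromRows hr
  exact ⟨hmn, u, k, hm, Z, C, hC.imp_right fun h => ⟨h, h.2.2.1, by omega⟩,
    equivalent_iff_indexedEquivalent.2 (hequiv.trans (indexedEquivalent_vcat hm Z C))⟩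

theorem IsACI.patternA_or_patternB_or_patternC {m n ρ : ℕ}
    {A : Matrix (Fin m) (Fin n) (MvPolynomial σ F)}
    (hA : IsACI A) (hr : HasConstantRank A ρ) (hρ : 1 ≤ ρ) (hlt : ρ < min m n) :
    PatternA A ρ ∨ PatternB A ρ ∨ PatternC A ρ := by
  obtain ⟨p, k, u, q, l, v, hm, hn, hpv, B, X, Y, Z, C, hB, hC, hequiv⟩ :=
    hA.exists_fromBlocks_fromCols_fromRows hr
  have h1 := hlt.trans_le (min_le_left m n)
  have h2 := hlt.trans_le (min_le_right m n)
  rcases Nat.eq_zero_or_pos v with rfl | hv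
  · refine .inr (.inl ⟨k + u, by omega, by omega, by omega, by omega, ?_⟩)
    rw [show m - (k + u) = p by omega]
    exact ⟨q, l, by omega, by omega, B, X, hB, equivalent_iff_indexedEquivalent.2
      (hequiv.trans (indexedEquivalent_vcat_hcat_zero (by omega) (by omega) B X Y _))⟩
  rcases Nat.eq_zero_or_pos p with rfl | hp
  · refine .inr (.inr ⟨q + l, by omega, by omega, by omega, by omega, ?_⟩)
    rw [show n - (q + l) = v by omega]
    exact ⟨k, u, by omega, by omega, Z, C, hC, equivalent_iff_indexedEquivalent.2
      (hequiv.trans (indexedEquivalent_hcat_zero_vcat (by omega) (by omega) _ Y Z C))⟩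
  · refine .inl ⟨k + u, q + l, by omega, by omega, by omega, by omega, by omega, by omega,
      by omega, ?_⟩
    rw [show m - (k + u) = p by omega, show n - (q + l) = v by omega]
    exact ⟨k, u, q, l, hm, hn, B, X, Y, Z, C, hB, hC, equivalent_iff_indexedEquivalent.2
      (hequiv.trans (indexedEquivalent_blockMatrix hm hn B X Y Z C))⟩

lemma lt_min_of_patternA_or_patternB_or_patternC {m n ρ : ℕ}
    {A : Matrix (Fin m) (Fin n) (MvPolynomial σ F)}
    (h : PatternA A ρ ∨ PatternB A ρ ∨ PatternC A ρ) : ρ < min m n := by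
  rcases h with ⟨r, s, _, _, _, _, _, _, _, -⟩ | ⟨r, _, _, _, _, -⟩ | ⟨s, _, _, _, _, -⟩ <;>
    exact lt_min (by omega) (by omega)

end Forms

end ACI

theorem mainTheorem1 {F σ : Type*} [Field F] (m n : ℕ)
    (A : Matrix (Fin m) (Fin n) (MvPolynomial σ F)) (hA : ACI.IsACI A) (ρ : ℕ) :
    (ACI.HasConstantRank A ρ ↔ ACI.HasBlockForm A ρ) ∧
    (ACI.HasConstantRank A ρ → 1 ≤ ρ → ρ ≤ min m n →
      ((ρ = m ∧ m = n) ↔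
        ∃ U : Matrix (Fin m) (Fin n) (MvPolynomial σ F),
          ACI.IsUpperUnitriangular U ∧ ACI.Equivalent A U) ∧
      ((ρ = m ∧ m < n) ↔ ACI.HasRowForm A) ∧
      ((ρ = n ∧ n < m) ↔ ACI.HasColForm A) ∧
      (ρ < min m n ↔ ACI.PatternA A ρ ∨ ACI.PatternB A ρ ∨ ACI.PatternC A ρ)) := by
  refine ⟨⟨hA.hasBlockForm, ACI.HasBlockForm.hasConstantRank⟩, fun hr hρ _ =>
    ⟨⟨?_, ?_⟩, ⟨?_, ?_⟩, ⟨?_, ?_⟩, hA.patternA_or_patternB_or_patternC hr hρ,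
      ACI.lt_min_of_patternA_or_patternB_or_patternC⟩⟩
  · rintro ⟨rfl, rfl⟩
    obtain ⟨U, hU, hequiv⟩ := hA.exists_unitriangular hr
    exact ⟨U, hU, ACI.equivalent_iff_indexedEquivalent.2 hequiv⟩
  · rintro ⟨U, hU, hequiv⟩
    exact ⟨hr.unique (hU.hasConstantRank_of_equivalent hequiv), hU.2.1⟩
  · rintro ⟨rfl, hlt⟩
    exact hA.hasRowForm hr hlt
  · exact fun h => ⟨hr.unique h.hasConstantRank, h.1⟩
  · rintro ⟨rfl, hlt⟩
    exact hA.hasColForm hr hlt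
  · exact fun h => ⟨hr.unique h.hasConstantRank, h.1⟩
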